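/- Let $p$ be a prime and let $\mathbb{Z}_{(p)}=\{a/b\in\mathbb{Q} : p\nmid b\}$. Let $(V,B)$ be a finite-dimensional $\mathbb{Q}$-vector space with a non-degenerate symmetric bilinear form, and let $L\subset V$ be a $\mathbb{Z}_{(p)}$-lattice, i.e. a finitely generated $\mathbb{Z}_{(p)}$-submodule with $\mathbb{Q}L=V$. For a finitely generated $\mathbb{Z}_{(p)}$-submodule $N\subseteq V$ let $N^{\#}=\{x\in \mathbb{Q}N : B(x,y)\in\mathbb{Z}_{(p)}\text{ for all }y\in N\}$ be its dual lattice in the subspace $\mathbb{Q}N$ of $V$; call $N$ unimodular if $N=N^{\#}$ and $p$-modular if $pN^{\#}=N$. Assume that $L$ is elementary, i.e. $pL^{\#}\subseteq L\subseteq L^{\#}$. Let $\sigma$ be an automorphism of $L$ of order $p$, i.e. a linear isometry of $(V,B)$ of order $p$ with $\sigma(L)=L$. Let $R=\mathbb{Z}_{(p)}\langle\sigma\rangle$ be the group ring of the cyclic group $\langle\sigma\rangle$ of order $p$, acting on $V$, and suppose that $L\cong R^a$ is a free $R$-module of rank $a$. Then: 1. $L^{\#}\cong R^a$ is also a free $R$-module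 of rank $a$. 2. There are an $R$-basis $(g_1,\dots,g_a)$ of $L^{\#}$ and $0\le t\le a$ such that $(g_1,\dots,g_t,pg_{t+1},\dots,pg_a)$ is an $R$-basis of $L$. 3. For every such basis and $t$, put $L_0=Rg_1\oplus\dots\oplus Rg_t$ and $L_1=L_0^{\perp}=\{x\in L : B(x,y)=0\text{ for all }y\in L_0\}$. Then $L$ is the orthogonal direct sum $L=L_0\perp L_1$, where $L_0$ is a unimodular free $R$-lattice of rank $t$ and $L_1$ is a $p$-modular free $R$-lattice of rank $a-t$. -/

import Mathlib

open scoped Pointwise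

/-- The localisation of `ℤ` at the prime `p`: the rational numbers whose reduced denominator is
not divisible by `p`. -/
def ZLoc (p : ℕ) [hp : Fact p.Prime] : Subring ℚ where
  carrier := {x | ¬ p ∣ x.den}
  one_mem' := by
    simpa using hp.out.one_lt.ne'
  zero_mem' := by
    simpa using hp.out.one_lt.ne'
  mul_mem' {x y} hx hy h :=
    ((hp.out.dvd_mul).1 (h.trans (Rat.mul_den_dvd x y))).elim hx hy
  add_mem' {x y} hx hy h :=
    ((hp.out.dvd_mul).1 (h.trans (Rat.add_den_dvd x y))).elim hx hy
  neg_mem' {x} hx := by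
    simpa using hx

section GroupRing

variable {V : Type*} [AddCommGroup V] [Module ℚ V]

/-- The group ring over `ℤ_(p)` of the cyclic group `⟨σ⟩` generated by `σ`. If `σ` has order `p`,
this is the group ring `R = ℤ_(p) C_p`. -/
abbrev LocGroupRing (p : ℕ) [Fact p.Prime] (σ : V ≃ₗ[ℚ] V) : Type _ :=
  MonoidAlgebra (ZLoc p) (Subgroup.zpowers σ)

/-- The ring homomorphism from the group ring to `End V` extending the action of `⟨σ⟩` on `V`. -/
noncomputable def groupRingAction (p : ℕ) [Fact p.Prime] (σ : V ≃ₗ[ℚ] V) :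
    LocGroupRing p σ →ₐ[ZLoc p] Module.End ℚ V :=
  MonoidAlgebra.lift (ZLoc p) (Module.End ℚ V) (Subgroup.zpowers σ)
    ((LinearEquiv.automorphismGroup.toLinearMapMonoidHom (R := ℚ) (M := V)).comp
      (Subgroup.zpowers σ).subtype)

/-- `V` as a module over the group ring of `⟨σ⟩`. -/
noncomputable instance groupRingModule (p : ℕ) [Fact p.Prime] (σ : V ≃ₗ[ℚ] V) :
    Module (LocGroupRing p σ) V :=
  Module.compHom V (groupRingAction p σ).toRingHom

theorem groupRing_smul_def (p : ℕ) [Fact p.Prime] (σ : V ≃ₗ[ℚ] V) (r : LocGroupRing p σ) (x : V) :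
    r • x = groupRingAction p σ r x := rfl

instance groupRing_isScalarTower (p : ℕ) [Fact p.Prime] (σ : V ≃ₗ[ℚ] V) :
    IsScalarTower (ZLoc p) (LocGroupRing p σ) V where
  smul_assoc c r x := by
    rw [groupRing_smul_def, groupRing_smul_def, map_smul, LinearMap.smul_apply]

/-- The `ℤ_(p)`-submodule `N` of `V` is an `R`-submodule (that is, stable under `σ`) and
`N ≅ R^a` as an `R`-module, for `R` the group ring of `⟨σ⟩`. -/
def IsFreeOfRank (p : ℕ) [Fact p.Prime] (σ : V ≃ₗ[ℚ] V) (N : Submodule (ZLoc p) V) (a : ℕ) :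
    Prop :=
  ∃ M : Submodule (LocGroupRing p σ) V,
    M.restrictScalars (ZLoc p) = N ∧ Nonempty (M ≃ₗ[LocGroupRing p σ] (Fin a → LocGroupRing p σ))

/-- The `R`-submodule of `V` generated by a set, regarded as a `ℤ_(p)`-submodule. -/
noncomputable def groupRingSpan (p : ℕ) [Fact p.Prime] (σ : V ≃ₗ[ℚ] V) (s : Set V) :
    Submodule (ZLoc p) V :=
  (Submodule.span (LocGroupRing p σ) s).restrictScalars (ZLoc p)

/-- The family `g` is an `R`-basis of `N`. -/
def IsGroupRingBasis (p : ℕ) [Fact p.Prime] (σ : V ≃ₗ[ℚ] V) {a : ℕ} (g : Fin a → V)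
    (N : Submodule (ZLoc p) V) : Prop :=
  LinearIndependent (LocGroupRing p σ) g ∧ groupRingSpan p σ (Set.range g) = N

end GroupRing

section Lattices

variable {V : Type*} [AddCommGroup V] [Module ℚ V]

/-- The dual of `N` in the subspace `ℚN` of `V` spanned by `N`:
all `x ∈ ℚN` with `B x y ∈ ℤ_(p)` for all `y ∈ N`. -/
def dualLattice (p : ℕ) [Fact p.Prime] (B : LinearMap.BilinForm ℚ V) (N : Submodule (ZLoc p) V) :
    Submodule (ZLoc p) V :=
  (Submodule.span ℚ (N : Set V)).restrictScalars (ZLoc p) ⊓ B.dualSubmodule N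

/-- For a lattice that spans `V`, the dual is `{x ∈ V | B x y ∈ ℤ_(p) for all y ∈ N}`. -/
theorem mem_dualLattice_of_span_eq_top (p : ℕ) [Fact p.Prime] (B : LinearMap.BilinForm ℚ V)
    (N : Submodule (ZLoc p) V) (hN : Submodule.span ℚ (N : Set V) = ⊤) (x : V) :
    x ∈ dualLattice p B N ↔ ∀ y ∈ N, B x y ∈ ZLoc p := by
  have key : ∀ q : ℚ, q ∈ (1 : Submodule (ZLoc p) ℚ) ↔ q ∈ ZLoc p := fun q => by
    rw [Submodule.mem_one]
    exact ⟨fun ⟨c, hc⟩ => hc ▸ c.2, fun h => ⟨⟨q, h⟩, rfl⟩⟩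
  simp [dualLattice, hN, LinearMap.BilinForm.mem_dualSubmodule, key]

/-- `N` is elementary: `p N^# ⊆ N ⊆ N^#`. -/
def IsElementary (p : ℕ) [Fact p.Prime] (B : LinearMap.BilinForm ℚ V)
    (N : Submodule (ZLoc p) V) : Prop :=
  (p : ℚ) • dualLattice p B N ≤ N ∧ N ≤ dualLattice p B N

/-- `N` is unimodular: `N = N^#`. -/
def IsUnimodular (p : ℕ) [Fact p.Prime] (B : LinearMap.BilinForm ℚ V)
    (N : Submodule (ZLoc p) V) : Prop :=
  N = dualLattice p B N

/-- `N` is `p`-modular: `p N^# = N`. -/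
def IsPModular (p : ℕ) [Fact p.Prime] (B : LinearMap.BilinForm ℚ V)
    (N : Submodule (ZLoc p) V) : Prop :=
  (p : ℚ) • dualLattice p B N = N

/-- The orthogonal complement of `N` in `L`. -/
def orthIn (p : ℕ) [Fact p.Prime] (B : LinearMap.BilinForm ℚ V) (L N : Submodule (ZLoc p) V) :
    Submodule (ZLoc p) V where
  carrier := {x | x ∈ L ∧ ∀ y ∈ N, B x y = 0}
  zero_mem' := ⟨L.zero_mem, fun y _ => by simp⟩
  add_mem' {x z} hx hz :=
    ⟨L.add_mem hx.1 hz.1, fun y hy => by simp [hx.2 y hy, hz.2 y hy]⟩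
  smul_mem' c x hx := ⟨L.smul_mem c hx.1, fun y hy => by
    rw [show c • x = (c : ℚ) • x from rfl]
    simp [hx.2 y hy]⟩

/-- `L` is the (internal direct) orthogonal sum of `N₀` and `N₁`. -/
def IsOrthogonalSum (p : ℕ) [Fact p.Prime] (B : LinearMap.BilinForm ℚ V)
    (L N₀ N₁ : Submodule (ZLoc p) V) : Prop :=
  N₀ ⊔ N₁ = L ∧ Disjoint N₀ N₁ ∧ ∀ x ∈ N₀, ∀ y ∈ N₁, B x y = 0

/-- `g` is an `R`-basis of `L^#` such that `(g_1, …, g_t, p g_{t+1}, …, p g_a)` is an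
`R`-basis of `L`. -/
def IsCompatibleBasis (p : ℕ) [Fact p.Prime] (B : LinearMap.BilinForm ℚ V) (σ : V ≃ₗ[ℚ] V)
    (L : Submodule (ZLoc p) V) {a : ℕ} (g : Fin a → V) (t : ℕ) : Prop :=
  IsGroupRingBasis p σ g (dualLattice p B L) ∧
    IsGroupRingBasis p σ (fun i => if i.val < t then g i else (p : ℚ) • g i) L

end Lattices

/-!
Write `R` for the group ring of `⟨σ⟩` over `ℤ_(p)`. Since `(σ - 1)^p` is divisible by `p` in `R`
and `R / (σ - 1) = ℤ_(p)`, the ring `R` is local with maximal ideal `𝔪 = (p, σ - 1)`.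

*Freeness of the dual.* The translates of an `R`-basis of `L` form a `ℚ`-basis of `V`. As `σ` is an
isometry, its dual basis again consists of translates, namely of the vectors dual to the `R`-basis
(`exists_isGroupRingBasis_dualLattice`).

*Stacked bases.* Put `M = L^#`. The point is that `L ∩ 𝔪 M = p M + 𝔪 L`: if `x ∈ L` is written as
`p y + (σ - 1) w` with `y, w ∈ M`, then `x - p y` lies in `L` and is killed by the norm element of
`R`, whose annihilator in a free module is the image of `σ - 1` (`exists_augGen_smul_eq`); so
`x - p y ∈ (σ - 1) L`. Now choose a basis of `M / 𝔪 M` that begins with a basis of the image of `L`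
and lift it to `g`, the first vectors inside `L`. By Nakayama's lemma `g` generates `M`, and the
first vectors together with `p` times the others generate `L` (`exists_stacked_generators`).
Generating systems of the right length are bases, by a dimension count over `ℚ`.

*The splitting.* Every element of `L` lies in `L₀ + p L^#`, so an element of `L₀` whose products
with `L₀` are divisible by `p` has all its products with `L` divisible by `p`. Hence it lies in
`p L^#`, and then in `p L₀` because `L₀` is a direct summand of `L^#`. Repeating this,
`L₀` is unimodular (`isUnimodular_of_decomposition`), so it splits off orthogonally
(`isOrthogonalSum_orthIn`), and `L ⊆ L₀ + p L^#` together with `p L^# ⊆ L` gives the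
`p`-modularity of the complement (`isPModular_orthIn`), on which the projections of the vectors
`p g_i` form an `R`-basis.
-/

open scoped Pointwise

/-! ### The ring `ℤ_(p)` -/

section ZLoc

variable {p : ℕ} [hp : Fact p.Prime]

instance : IsFractionRing (ZLoc p) ℚ := by
  refine IsFractionRing.of_field (ZLoc p) ℚ fun q =>
    ⟨(q.num : ZLoc p), (q.den : ZLoc p), ?_⟩
  simpa using (Rat.num_div_den q).symm

theorem inv_natCast_mem_ZLoc {n : ℕ} (hn : ¬ p ∣ n) : (n : ℚ)⁻¹ ∈ ZLoc p := by
  have hn0 : n ≠ 0 := fun h => hn (h ▸ dvd_zero p)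
  change ¬ p ∣ ((n : ℚ)⁻¹).den
  rwa [Rat.inv_natCast_den_of_pos (Nat.pos_of_ne_zero hn0)]

/-- `ℤ_(p)` is local with maximal ideal generated by `p`. -/
theorem isUnit_or_dvd_ZLoc (c : ZLoc p) : IsUnit c ∨ (p : ZLoc p) ∣ c := by
  have hden : ((c : ℚ).den : ℚ)⁻¹ ∈ ZLoc p := inv_natCast_mem_ZLoc c.2
  have hc : (c : ℚ) = (c : ℚ).num * ((c : ℚ).den : ℚ)⁻¹ := by
    rw [← div_eq_mul_inv, Rat.num_div_den]
  by_cases h : (p : ℤ) ∣ (c : ℚ).num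
  · right
    obtain ⟨k, hk⟩ := h
    refine ⟨k * ⟨_, hden⟩, Subtype.ext ?_⟩
    refine hc.trans ?_
    rw [hk]
    push_cast
    ring
  · left
    have hnum : ¬ p ∣ ((c : ℚ)⁻¹).den := by
      have h0 : (c : ℚ).num ≠ 0 := fun h' => h (h' ▸ dvd_zero _)
      rw [Rat.den_inv_of_ne_zero (by simpa using h0)]
      rwa [← Int.natCast_dvd]
    have h0 : (c : ℚ) ≠ 0 := by
      intro h'
      exact h (by simp [h'])
    exact IsUnit.of_mul_eq_one ⟨(c : ℚ)⁻¹, hnum⟩ (Subtype.ext (mul_inv_cancel₀ h0))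

theorem natCast_not_isUnit_ZLoc : ¬ IsUnit (p : ZLoc p) := by
  rintro ⟨u, hu⟩
  have h : ¬ p ∣ (((u⁻¹ : (ZLoc p)ˣ) : ZLoc p) : ℚ).den := (u⁻¹).1.2
  have hmul : (p : ℚ) * (((u⁻¹ : (ZLoc p)ˣ) : ZLoc p) : ℚ) = 1 := by
    have := congrArg (Subtype.val) (u.mul_inv)
    rw [hu] at this
    simpa using this
  rw [eq_inv_of_mul_eq_one_right hmul, Rat.inv_natCast_den_of_pos hp.out.pos] at h
  exact h dvd_rfl

theorem natCast_mem_of_isMaximal_ZLoc (I : Ideal (ZLoc p)) [hI : I.IsMaximal] :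
    (p : ZLoc p) ∈ I := by
  by_contra h
  obtain ⟨y, i, hi, hy⟩ := hI.exists_inv h
  rcases isUnit_or_dvd_ZLoc i with hu | hd
  · exact hI.ne_top (Ideal.eq_top_of_isUnit_mem _ hi hu)
  · refine natCast_not_isUnit_ZLoc (p := p) (isUnit_of_dvd_one ?_)
    rw [← hy]
    exact dvd_add (dvd_mul_left _ _) hd

/-- Every nonzero integer is a power of `p` up to units of `ℤ_(p)`. -/
theorem exists_mul_eq_pow_ZLoc {n : ℕ} (hn : n ≠ 0) :
    ∃ (c : ZLoc p) (k : ℕ), (c : ℚ) * n = p ^ k := by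
  obtain ⟨k, u, hu, rfl⟩ := Nat.exists_eq_pow_mul_and_not_dvd hn p hp.out.ne_one
  refine ⟨⟨_, inv_natCast_mem_ZLoc hu⟩, k, ?_⟩
  have hu0 : (u : ℚ) ≠ 0 := by
    rintro h
    exact hu (by simp [Nat.cast_eq_zero.1 h])
  push_cast
  field_simp

/-- `ℤ_(p)` contains no nonzero `ℚ`-subspace of `ℚ`. -/
theorem eq_zero_of_forall_mul_mem_ZLoc {q : ℚ} (h : ∀ r : ℚ, r * q ∈ ZLoc p) : q = 0 := by
  by_contra hq
  have := h ((p : ℚ)⁻¹ * q⁻¹)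
  rw [mul_assoc, inv_mul_cancel₀ hq, mul_one] at this
  have h' : ¬ p ∣ ((p : ℚ)⁻¹).den := this
  rw [Rat.inv_natCast_den_of_pos hp.out.pos] at h'
  exact h' dvd_rfl

end ZLoc

/-! ### Stacked generators over a local ring -/

section AdaptedBasis

/-- A subspace of an `a`-dimensional space is spanned by the first vectors of some basis. -/
theorem exists_basis_initial_span {K U : Type*} [Field K] [AddCommGroup U] [Module K U]
    [FiniteDimensional K U] {a : ℕ} (ha : Module.finrank K U = a) (W : Submodule K U) :
    ∃ (b : Module.Basis (Fin a) K U) (t : ℕ), t ≤ a ∧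
      Submodule.span K (b '' {i | i.val < t}) = W := by
  obtain ⟨W', hW⟩ := W.exists_isCompl
  have hsum : Module.finrank K W + Module.finrank K W' = a :=
    (Submodule.finrank_add_eq_of_isCompl hW).trans ha
  subst hsum
  let b := (((Module.finBasis K W).prod (Module.finBasis K W')).map
    (Submodule.prodEquivOfIsCompl W W' hW)).reindex finSumFinEquiv
  refine ⟨b, Module.finrank K W, Nat.le_add_right _ _, ?_⟩
  have hb : b '' {i | i.val < Module.finrank K W} =
      Set.range (W.subtype ∘ Module.finBasis K W) := by
    ext x
    constructor
    · rintro ⟨i, hi, rfl⟩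
      obtain ⟨j, rfl⟩ : ∃ j, finSumFinEquiv (Sum.inl j) = i := ⟨⟨i.val, hi⟩, rfl⟩
      exact ⟨j, by simp [b]⟩
    · rintro ⟨i, rfl⟩
      exact ⟨finSumFinEquiv (Sum.inl i), by simp, by simp [b]⟩
  rw [hb, Set.range_comp, Submodule.span_image, (Module.finBasis K W).span_eq,
    Submodule.map_top, Submodule.range_subtype]

variable {R V : Type*} [CommRing R] [AddCommGroup V] [Module R V]

/-- Stacked generators over a local ring: if `c M ⊆ L ⊆ M` with `M` free and
`L ∩ 𝔪 M = c M + 𝔪 L`, then lifting a basis of `M / 𝔪 M` adapted to the image of `L` yields,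
by Nakayama's lemma, generators `g` of `M` such that replacing the last ones by their multiples
by `c` yields generators of `L`. -/
theorem exists_stacked_generators (m : Ideal R) [m.IsMaximal] (hm : m ≤ (⊥ : Ideal R).jacobson)
    {c : R} {L M : Submodule R V} (hL : L.FG) (hLM : L ≤ M)
    (hcM : ∀ x ∈ M, c • x ∈ L)
    (hint : ∀ x ∈ L, x ∈ m • M → ∃ y ∈ M, x - c • y ∈ m • L)
    {a : ℕ} (e : Module.Basis (Fin a) R M) :
    ∃ (g : Fin a → V) (t : ℕ), t ≤ a ∧ Submodule.span R (Set.range g) = M ∧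
      Submodule.span R (Set.range fun i => if i.val < t then g i else c • g i) = L := by
  let _ := Ideal.Quotient.field m
  let φ : M →ₗ[R] (Fin a → R ⧸ m) :=
    LinearMap.pi fun i => (Submodule.mkQ m) ∘ₗ e.coord i
  have hφsurj : Function.Surjective φ := fun y => by
    choose r hr using fun i => Ideal.Quotient.mk_surjective (y i)
    refine ⟨∑ i, r i • e i, funext fun i => ?_⟩
    simp only [φ, LinearMap.pi_apply, LinearMap.comp_apply, Module.Basis.coord_apply,
      e.repr_sum_self]
    exact hr i
  have hφker : ∀ x : M, φ x = 0 → (x : V) ∈ m • M := fun x hx => by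
    rw [← e.sum_repr x, Submodule.coe_sum]
    refine Submodule.sum_mem _ fun i _ => Submodule.smul_mem_smul ?_ (e i).2
    exact Ideal.Quotient.eq_zero_iff_mem.1 (congrFun hx i)
  have hφsmul : ∀ (r : R) (x : M), φ (r • x) = Ideal.Quotient.mk m r • φ x := fun r x => by
    rw [map_smul]; rfl
  let L' : Submodule R M := L.comap M.subtype
  let W : Submodule (R ⧸ m) (Fin a → R ⧸ m) := Submodule.span (R ⧸ m) (φ '' L')
  have hW : ∀ w ∈ W, ∃ x ∈ L', φ x = w := fun w hw => by
    have h := Submodule.restrictScalars_span R (R ⧸ m) Ideal.Quotient.mk_surjective (φ '' L')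
    have hw' : w ∈ (Submodule.span (R ⧸ m) (φ '' L')).restrictScalars R := hw
    rw [h, Submodule.span_image, Submodule.span_eq] at hw'
    exact hw'
  obtain ⟨b, t, hta, hb⟩ := exists_basis_initial_span (K := R ⧸ m) (a := a) (by simp) W
  have hlift : ∀ i : Fin a, ∃ x : M, φ x = b i ∧ (i.val < t → (x : V) ∈ L) := fun i => by
    by_cases hi : i.val < t
    · obtain ⟨x, hx, hxb⟩ := hW (b i) (hb ▸ Submodule.subset_span ⟨i, hi, rfl⟩)
      exact ⟨x, hxb, fun _ => hx⟩
    · obtain ⟨x, hx⟩ := hφsurj (b i)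
      exact ⟨x, hx, fun h => absurd h hi⟩
  choose g hgb hgL using hlift
  have hgM : Submodule.span R (Set.range fun i => (g i : V)) = M := by
    refine le_antisymm (Submodule.span_le.2 (by rintro _ ⟨i, rfl⟩; exact (g i).2)) ?_
    have hMfg : M.FG := by
      have : Module.Finite R M := Module.Finite.of_basis e
      exact Module.Finite.iff_fg.1 this
    refine Submodule.le_of_le_smul_of_le_jacobson_bot hMfg hm fun x hx => ?_
    choose r hr using fun i => Ideal.Quotient.mk_surjective (b.repr (φ ⟨x, hx⟩) i)
    rw [← add_sub_cancel (∑ i, r i • (g i : V)) x]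
    refine Submodule.add_mem_sup (Submodule.sum_mem _ fun i _ =>
      Submodule.smul_mem _ _ (Submodule.subset_span ⟨i, rfl⟩)) ?_
    have := hφker (⟨x, hx⟩ - ∑ i, r i • g i) (by
      rw [map_sub, map_sum, sub_eq_zero]
      simp only [hφsmul, hr, hgb]
      exact (b.sum_repr _).symm)
    simpa using this
  refine ⟨fun i => g i, t, hta, hgM, ?_⟩
  set f : Fin a → V := fun i => if i.val < t then (g i : V) else c • (g i : V) with hf
  refine le_antisymm (Submodule.span_le.2 ?_) ?_
  · rintro _ ⟨i, rfl⟩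
    by_cases hi : i.val < t
    · simpa [hf, hi] using hgL i hi
    · simpa [hf, hi] using hcM _ (g i).2
  refine Submodule.le_of_le_smul_of_le_jacobson_bot hL hm fun x hx => ?_
  have hgf : ∀ i : Fin a, i.val < t → (g i : V) ∈ Submodule.span R (Set.range f) := fun i hi =>
    Submodule.subset_span ⟨i, by simp [hf, hi]⟩
  have hcgf : ∀ y ∈ M, c • y ∈ Submodule.span R (Set.range f) := fun y hy => by
    rw [← hgM] at hy
    induction hy using Submodule.span_induction with
    | mem y hy =>
      obtain ⟨i, rfl⟩ := hy
      by_cases hi : i.val < t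
      · exact Submodule.smul_mem _ _ (hgf i hi)
      · exact Submodule.subset_span ⟨i, by simp [hf, hi]⟩
    | zero => simp
    | add y z _ _ hy hz => rw [smul_add]; exact add_mem hy hz
    | smul r y _ hy => rw [smul_comm]; exact Submodule.smul_mem _ r hy
  have hxW : φ ⟨x, hLM hx⟩ ∈ Submodule.span (R ⧸ m) (b '' {i | i.val < t}) :=
    hb ▸ Submodule.subset_span ⟨_, hx, rfl⟩
  -- lift an expression of the image of `x` in terms of the first `t` vectors of `b`
  obtain ⟨u, huf, huL, huφ⟩ : ∃ u : M, (u : V) ∈ Submodule.span R (Set.range f) ∧ (u : V) ∈ L ∧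
      φ u = φ ⟨x, hLM hx⟩ := by
    generalize φ ⟨x, hLM hx⟩ = w at hxW
    induction hxW using Submodule.span_induction with
    | mem w hw =>
      obtain ⟨i, hi, rfl⟩ := hw
      exact ⟨g i, hgf i hi, hgL i hi, hgb i⟩
    | zero => exact ⟨0, zero_mem _, zero_mem _, map_zero φ⟩
    | add w₁ w₂ _ _ h₁ h₂ =>
      obtain ⟨u₁, h₁, h₁', rfl⟩ := h₁
      obtain ⟨u₂, h₂, h₂', rfl⟩ := h₂
      exact ⟨u₁ + u₂, add_mem h₁ h₂, add_mem h₁' h₂', map_add φ _ _⟩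
    | smul r w _ h =>
      obtain ⟨u, h, h', rfl⟩ := h
      obtain ⟨s, rfl⟩ := Ideal.Quotient.mk_surjective r
      exact ⟨s • u, Submodule.smul_mem _ _ h, Submodule.smul_mem _ _ h', hφsmul s u⟩
  have hxu : x - u ∈ m • M := by
    simpa using hφker (⟨x, hLM hx⟩ - u) (by rw [map_sub, huφ, sub_self])
  obtain ⟨y, hy, hyL⟩ := hint _ (sub_mem hx huL) hxu
  rw [show x = (u + c • y) + (x - u - c • y) by abel]
  exact Submodule.add_mem_sup (add_mem huf (hcgf y hy)) hyL

end AdaptedBasis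

/-! ### The group ring and its maximal ideal -/

section GroupRing

variable {p : ℕ} [hp : Fact p.Prime] {V : Type*} [AddCommGroup V] [Module ℚ V]

/-- The group ring of a cyclic group is commutative. -/
noncomputable instance (σ : V ≃ₗ[ℚ] V) : CommRing (LocGroupRing p σ) where
  mul_comm x y := by
    induction x using MonoidAlgebra.induction_on with
    | of g =>
      induction y using MonoidAlgebra.induction_on with
      | of h =>
        rw [← map_mul, ← map_mul]
        exact congrArg _ (Subtype.ext (Subgroup.mem_zpowers_iff.1 g.2 |>.elim fun m hm =>
          Subgroup.mem_zpowers_iff.1 h.2 |>.elim fun n hn => by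
            simp only [Subgroup.coe_mul, ← hm, ← hn, ← zpow_add, add_comm]))
      | add y z hy hz => rw [mul_add, add_mul, hy, hz]
      | smul r y hy => rw [mul_smul_comm, smul_mul_assoc, hy]
    | add x z hx hz => rw [mul_add, add_mul, hx, hz]
    | smul r x hx => rw [mul_smul_comm, smul_mul_assoc, hx]

variable {σ : V ≃ₗ[ℚ] V}

theorem of_smul (h : Subgroup.zpowers σ) (x : V) :
    (MonoidAlgebra.of (ZLoc p) _ h : LocGroupRing p σ) • x = (h : V ≃ₗ[ℚ] V) x := by
  rw [groupRing_smul_def, groupRingAction, MonoidAlgebra.lift_of]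
  rfl

theorem groupRing_smul_map_smul (r : LocGroupRing p σ) (q : ℚ) (x : V) :
    r • (q • x) = q • (r • x) := by
  simp only [groupRing_smul_def, map_smul]

theorem groupRing_natCast_smul (n : ℕ) (x : V) : (n : LocGroupRing p σ) • x = (n : ℚ) • x := by
  rw [Nat.cast_smul_eq_nsmul, Nat.cast_smul_eq_nsmul]

/-- A `ℤ_(p)`-submodule that is stable under the group is a submodule for the group ring. -/
theorem exists_restrictScalars_eq {N : Submodule (ZLoc p) V}
    (hN : ∀ (h : Subgroup.zpowers σ), ∀ x ∈ N, (h : V ≃ₗ[ℚ] V) x ∈ N) :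
    ∃ M : Submodule (LocGroupRing p σ) V, M.restrictScalars (ZLoc p) = N := by
  refine ⟨{ N.toAddSubmonoid with smul_mem' := fun r x hx => ?_ }, rfl⟩
  change x ∈ N at hx
  change r • x ∈ N
  induction r using MonoidAlgebra.induction_on with
  | of h => rw [of_smul]; exact hN h x hx
  | add r s hr hs => rw [add_smul]; exact add_mem hr hs
  | smul c r hr => rw [smul_assoc]; exact N.smul_mem c hr

/-- The family of all translates `h (g i)` of a family `g` under the cyclic group. -/
def orbitFamily (σ : V ≃ₗ[ℚ] V) {ι : Type*} (g : ι → V) (x : Subgroup.zpowers σ × ι) : V :=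
  (x.1 : V ≃ₗ[ℚ] V) (g x.2)

theorem orbitFamily_eq (p : ℕ) [Fact p.Prime] {ι : Type*} (g : ι → V) :
    orbitFamily σ g =
      fun x => (MonoidAlgebra.of (ZLoc p) _ x.1 : LocGroupRing p σ) • g x.2 :=
  funext fun x => (of_smul x.1 (g x.2)).symm

theorem span_orbitFamily (p : ℕ) [Fact p.Prime] {ι : Type*} (g : ι → V) :
    Submodule.span (ZLoc p) (Set.range (orbitFamily σ g)) = groupRingSpan p σ (Set.range g) := by
  have h : Set.range (orbitFamily σ g) =
      Set.range (MonoidAlgebra.of (ZLoc p) (Subgroup.zpowers σ)) • Set.range g := by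
    rw [orbitFamily_eq p]
    exact (Set.range_smul_range _ _).symm
  rw [h, groupRingSpan]
  refine Submodule.span_smul_of_span_eq_top (eq_top_iff.2 fun r _ => ?_) _
  induction r using MonoidAlgebra.induction_on with
  | of h => exact Submodule.subset_span ⟨h, rfl⟩
  | add r s hr hs => exact add_mem (hr trivial) (hs trivial)
  | smul c r hr => exact Submodule.smul_mem _ c (hr trivial)

/-- Linear independence over the group ring amounts to linear independence over `ℚ` of all
translates. -/
theorem linearIndependent_groupRing_iff [Finite (Subgroup.zpowers σ)] {ι : Type*} [Finite ι]
    (g : ι → V) :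
    LinearIndependent (LocGroupRing p σ) g ↔ LinearIndependent ℚ (orbitFamily σ g) := by
  rw [← LinearIndependent.iff_fractionRing (ZLoc p) ℚ, orbitFamily_eq p]
  constructor
  · intro hg
    exact linearIndependent_smul
      (MonoidAlgebra.basis (Subgroup.zpowers σ) (ZLoc p)).linearIndependent hg
  · intro hg
    cases nonempty_fintype ι
    cases nonempty_fintype (Subgroup.zpowers σ)
    rw [Fintype.linearIndependent_iff] at hg ⊢
    intro r hr i
    let B := MonoidAlgebra.basis (Subgroup.zpowers σ) (ZLoc p)
    have key := hg (fun x => B.repr (r x.2) x.1) (by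
      rw [Fintype.sum_prod_type_right, ← hr]
      refine Finset.sum_congr rfl fun j _ => ?_
      conv_rhs => rw [← B.sum_repr (r j), Finset.sum_smul]
      refine Finset.sum_congr rfl fun h _ => ?_
      rw [smul_assoc]
      rfl)
    rw [← B.sum_repr (r i)]
    exact Finset.sum_eq_zero fun h _ => by rw [key (h, i), zero_smul]

theorem isFreeOfRank_groupRingSpan {ι : Type*} [Fintype ι] {a : ℕ} (hι : Fintype.card ι = a)
    {g : ι → V} (hg : LinearIndependent (LocGroupRing p σ) g) :
    IsFreeOfRank p σ (groupRingSpan p σ (Set.range g)) a :=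
  ⟨Submodule.span _ (Set.range g), rfl,
    ⟨((Module.Basis.span hg).reindex (Fintype.equivFinOfCardEq hι)).equivFun⟩⟩

/-- An `R`-generating system of a full lattice with as many elements as an `R`-basis is an
`R`-basis, by counting dimensions over `ℚ`. -/
theorem isGroupRingBasis_of_groupRingSpan_eq [FiniteDimensional ℚ V] [Finite (Subgroup.zpowers σ)]
    {a : ℕ} {e g : Fin a → V} {L N : Submodule (ZLoc p) V}
    (hL : Submodule.span ℚ (L : Set V) = ⊤) (hN : Submodule.span ℚ (N : Set V) = ⊤)
    (he : IsGroupRingBasis p σ e L) (hg : groupRingSpan p σ (Set.range g) = N) :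
    IsGroupRingBasis p σ g N := by
  cases nonempty_fintype (Subgroup.zpowers σ)
  refine ⟨?_, hg⟩
  have htop : ∀ (f : Fin a → V) (P : Submodule (ZLoc p) V), Submodule.span ℚ (P : Set V) = ⊤ →
      groupRingSpan p σ (Set.range f) = P → Submodule.span ℚ (Set.range (orbitFamily σ f)) = ⊤ := by
    rintro f P hP rfl
    rwa [← span_orbitFamily, Submodule.span_span_of_tower] at hP
  rw [linearIndependent_groupRing_iff]
  have hb := Module.finrank_eq_card_basis
    (Module.Basis.mk ((linearIndependent_groupRing_iff e).1 he.1) (htop e L hL he.2).ge)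
  exact linearIndependent_of_top_le_span_of_card_eq_finrank (htop g N hN hg).ge hb.symm

theorem IsFreeOfRank.exists_isGroupRingBasis {N : Submodule (ZLoc p) V} {a : ℕ}
    (h : IsFreeOfRank p σ N a) : ∃ g : Fin a → V, IsGroupRingBasis p σ g N := by
  obtain ⟨M, rfl, ⟨e⟩⟩ := h
  let b := Module.Basis.ofEquivFun e
  refine ⟨fun i => b i, b.linearIndependent.map' M.subtype M.ker_subtype, ?_⟩
  rw [groupRingSpan, show (fun i => (b i : V)) = M.subtype ∘ b from rfl, Set.range_comp,
    Submodule.span_image, b.span_eq, Submodule.map_top, Submodule.range_subtype]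

theorem IsGroupRingBasis.isFreeOfRank {N : Submodule (ZLoc p) V} {a : ℕ} {g : Fin a → V}
    (h : IsGroupRingBasis p σ g N) : IsFreeOfRank p σ N a :=
  h.2 ▸ isFreeOfRank_groupRingSpan (Fintype.card_fin a) h.1

end GroupRing

section Augmentation

variable {p : ℕ} [hp : Fact p.Prime] {V : Type*} [AddCommGroup V] [Module ℚ V] (σ : V ≃ₗ[ℚ] V)

variable (p) in
/-- The element `σ - 1` of the group ring, a generator of the augmentation ideal. -/
noncomputable def augGen : LocGroupRing p σ :=
  MonoidAlgebra.of (ZLoc p) _ ⟨σ, Subgroup.mem_zpowers σ⟩ - 1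

variable (p) in
/-- The norm element, the sum of all elements of the cyclic group. -/
noncomputable def normElt [Fintype (Subgroup.zpowers σ)] : LocGroupRing p σ :=
  ∑ h : Subgroup.zpowers σ, MonoidAlgebra.of (ZLoc p) _ h

variable {σ}

/-- The quotient of the group ring by `σ - 1` is `ℤ_(p)`. -/
theorem exists_sub_algebraMap_mul_augGen [Finite (Subgroup.zpowers σ)] (r : LocGroupRing p σ) :
    ∃ (c : ZLoc p) (s : LocGroupRing p σ), r = algebraMap _ _ c + augGen p σ * s := by
  induction r using MonoidAlgebra.induction_on with
  | of h =>
    let γ : Subgroup.zpowers σ := ⟨σ, Subgroup.mem_zpowers σ⟩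
    obtain ⟨n, hh⟩ : ∃ n : ℕ, γ ^ n = h := by
      have hγ : h ∈ Subgroup.zpowers γ := by
        obtain ⟨k, hk⟩ := h.2
        exact ⟨k, Subtype.ext hk⟩
      exact (isOfFinOrder_of_finite γ).mem_powers_iff_mem_zpowers.2 hγ
    obtain ⟨s, hs⟩ := sub_one_dvd_pow_sub_one
      (MonoidAlgebra.of (ZLoc p) (Subgroup.zpowers σ) ⟨σ, Subgroup.mem_zpowers σ⟩) n
    refine ⟨1, s, ?_⟩
    rw [← hh, map_pow, map_one, augGen, ← hs]
    ring
  | add r s hr hs =>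
    obtain ⟨c, u, rfl⟩ := hr
    obtain ⟨c', u', rfl⟩ := hs
    exact ⟨c + c', u + u', by rw [map_add]; ring⟩
  | smul k r hr =>
    obtain ⟨c, u, rfl⟩ := hr
    exact ⟨k * c, k • u, by
      rw [map_mul, smul_add, mul_smul_comm, Algebra.smul_def k (algebraMap _ _ c)]⟩

theorem normElt_mul_augGen [Fintype (Subgroup.zpowers σ)] : normElt p σ * augGen p σ = 0 := by
  rw [normElt, augGen, mul_sub, mul_one, Finset.sum_mul, sub_eq_zero]
  simp only [← map_mul]
  exact Fintype.sum_equiv (Equiv.mulRight _) _ _ fun _ => rfl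

/-- The annihilator of the norm element is generated by `σ - 1`. -/
theorem augGen_dvd_of_normElt_mul_eq_zero [Fintype (Subgroup.zpowers σ)] {r : LocGroupRing p σ}
    (hr : normElt p σ * r = 0) : augGen p σ ∣ r := by
  obtain ⟨c, s, rfl⟩ := exists_sub_algebraMap_mul_augGen r
  rw [mul_add, ← mul_assoc, normElt_mul_augGen, zero_mul, add_zero, mul_comm,
    ← Algebra.smul_def, normElt, Finset.smul_sum] at hr
  have hc := Fintype.linearIndependent_iff.1
    (MonoidAlgebra.basis (Subgroup.zpowers σ) (ZLoc p)).linearIndependent (fun _ => c) hr 1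
  exact ⟨s, by rw [hc, map_zero, zero_add]⟩

theorem natCast_dvd_augGen_pow (hσ : orderOf σ = p) :
    (p : LocGroupRing p σ) ∣ augGen p σ ^ p := by
  obtain ⟨r, hr⟩ := exists_add_pow_prime_eq hp.out (augGen p σ) 1
  have h1 : (augGen p σ + 1) ^ p = 1 := by
    rw [augGen, sub_add_cancel, ← map_pow, ← map_one (MonoidAlgebra.of (ZLoc p) _)]
    exact congrArg _ (Subtype.ext (by simpa [hσ] using pow_orderOf_eq_one σ))
  refine ⟨-(augGen p σ * r), ?_⟩
  rw [h1] at hr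
  linear_combination -hr

variable (p σ) in
/-- The ideal generated by `p` and `σ - 1`, the maximal ideal of the group ring. -/
noncomputable def groupRingMaxIdeal : Ideal (LocGroupRing p σ) :=
  Ideal.span {(p : LocGroupRing p σ), augGen p σ}

theorem groupRingMaxIdeal_le_of_isMaximal [Finite (Subgroup.zpowers σ)] (hσ : orderOf σ = p)
    (I : Ideal (LocGroupRing p σ)) [hI : I.IsMaximal] : groupRingMaxIdeal p σ ≤ I := by
  have hpI : (p : LocGroupRing p σ) ∈ I := by
    have := Ideal.isMaximal_comap_of_isIntegral_of_isMaximal (R := ZLoc p) I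
    simpa using natCast_mem_of_isMaximal_ZLoc (I.comap (algebraMap (ZLoc p) (LocGroupRing p σ)))
  rw [groupRingMaxIdeal, Ideal.span_le]
  rintro x (rfl | rfl)
  · exact hpI
  · exact hI.isPrime.mem_of_pow_mem p (I.mem_of_dvd (natCast_dvd_augGen_pow hσ) hpI)

theorem groupRingMaxIdeal_le_jacobson [Finite (Subgroup.zpowers σ)] (hσ : orderOf σ = p) :
    groupRingMaxIdeal p σ ≤ (⊥ : Ideal (LocGroupRing p σ)).jacobson :=
  le_sInf fun I hI => by
    have := hI.2
    exact groupRingMaxIdeal_le_of_isMaximal hσ I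

theorem isMaximal_groupRingMaxIdeal [Finite (Subgroup.zpowers σ)] (hσ : orderOf σ = p) :
    (groupRingMaxIdeal p σ).IsMaximal := by
  obtain ⟨I, hI⟩ := Ideal.exists_maximal (LocGroupRing p σ)
  suffices groupRingMaxIdeal p σ = I by rwa [this]
  refine le_antisymm (groupRingMaxIdeal_le_of_isMaximal hσ I) fun r hr => ?_
  have hle := groupRingMaxIdeal_le_of_isMaximal hσ I
  have hd : augGen p σ ∈ groupRingMaxIdeal p σ := Ideal.subset_span (by simp)
  obtain ⟨c, s, rfl⟩ := exists_sub_algebraMap_mul_augGen r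
  refine add_mem ?_ (Ideal.mul_mem_right _ _ hd)
  have hc : algebraMap _ _ c ∈ I := (I.add_mem_iff_left (I.mul_mem_right s (hle hd))).1 hr
  rcases isUnit_or_dvd_ZLoc c with hu | ⟨k, rfl⟩
  · exact absurd (Ideal.eq_top_of_isUnit_mem _ hc (hu.map _)) hI.ne_top
  -- a non-unit of `ℤ_(p)` is divisible by `p`
  · rw [map_mul, map_natCast]
    exact Ideal.mul_mem_right _ _ (Ideal.subset_span (by simp))

end Augmentation

/-! ### Elementary lattices -/

section Lattices

variable {p : ℕ} [hp : Fact p.Prime] {V : Type*} [AddCommGroup V] [Module ℚ V]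
  {B : LinearMap.BilinForm ℚ V}

theorem mem_dualLattice_iff (N : Submodule (ZLoc p) V) (x : V) :
    x ∈ dualLattice p B N ↔ x ∈ Submodule.span ℚ (N : Set V) ∧ ∀ y ∈ N, B x y ∈ ZLoc p := by
  have key : ∀ q : ℚ, q ∈ (1 : Submodule (ZLoc p) ℚ) ↔ q ∈ ZLoc p := fun q => by
    rw [Submodule.mem_one]
    exact ⟨fun ⟨c, hc⟩ => hc ▸ c.2, fun h => ⟨⟨q, h⟩, rfl⟩⟩
  simp [dualLattice, LinearMap.BilinForm.mem_dualSubmodule, key]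

theorem ratCast_smul_mem {N : Submodule (ZLoc p) V} {q : ℚ} (hq : q ∈ ZLoc p) {x : V} (hx : x ∈ N) :
    q • x ∈ N :=
  N.smul_mem ⟨q, hq⟩ hx

theorem natCast_smul_mem {N : Submodule (ZLoc p) V} (n : ℕ) {x : V} (hx : x ∈ N) :
    (n : ℚ) • x ∈ N :=
  ratCast_smul_mem (natCast_mem _ n) hx

/-- Denominators in `ℚN` can be cleared by a power of `p`. -/
theorem exists_pow_smul_mem {N : Submodule (ZLoc p) V} {x : V}
    (hx : x ∈ Submodule.span ℚ (N : Set V)) : ∃ k : ℕ, (p : ℚ) ^ k • x ∈ N := by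
  suffices ∃ n : ℕ, n ≠ 0 ∧ (n : ℚ) • x ∈ N by
    obtain ⟨n, hn, hnx⟩ := this
    obtain ⟨c, k, hck⟩ := exists_mul_eq_pow_ZLoc (p := p) hn
    exact ⟨k, by rw [← hck, mul_smul]; exact ratCast_smul_mem c.2 hnx⟩
  induction hx using Submodule.span_induction with
  | mem x hx => exact ⟨1, one_ne_zero, natCast_smul_mem 1 hx⟩
  | zero => exact ⟨1, one_ne_zero, by simp⟩
  | add x y _ _ hx hy =>
    obtain ⟨m, hm, hx⟩ := hx
    obtain ⟨n, hn, hy⟩ := hy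
    refine ⟨m * n, mul_ne_zero hm hn, ?_⟩
    rw [smul_add]
    refine add_mem ?_ ?_
    · rw [Nat.cast_mul, mul_comm, mul_smul]
      exact natCast_smul_mem n hx
    · rw [Nat.cast_mul, mul_smul]
      exact natCast_smul_mem m hy
  | smul q x _ hx =>
    obtain ⟨m, hm, hx⟩ := hx
    refine ⟨m * q.den, mul_ne_zero hm q.den_nz, ?_⟩
    have : ((m * q.den : ℕ) : ℚ) * q = q.num * m := by
      rw [Nat.cast_mul, mul_assoc, Rat.den_mul_eq_num, mul_comm]
    rw [← mul_smul, this, mul_smul]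
    exact ratCast_smul_mem (intCast_mem _ _) hx

/-- If `L ⊆ L₀ + p L^#`, then an element of `L₀` whose products with `L₀` are divisible by `p` lies
in `p L^#`. If moreover `L₀ ∩ p L^# = p L₀`, this lets one divide by `p` until every element of the
dual of `L₀` is seen to lie in `L₀`. -/
theorem isUnimodular_of_decomposition (hB : B.IsSymm) {L L₀ : Submodule (ZLoc p) V}
    (hspan : Submodule.span ℚ (L : Set V) = ⊤) (hL : L ≤ dualLattice p B L) (hL₀ : L₀ ≤ L)
    (hdec : ∀ x ∈ L, ∃ l ∈ L₀, ∃ w ∈ dualLattice p B L, x = l + (p : ℚ) • w)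
    (hsat : ∀ y ∈ L₀, (p : ℚ)⁻¹ • y ∈ dualLattice p B L → (p : ℚ)⁻¹ • y ∈ L₀) :
    IsUnimodular p B L₀ := by
  have hp0 : (p : ℚ) ≠ 0 := Nat.cast_ne_zero.2 hp.out.ne_zero
  have hint : ∀ x ∈ L, ∀ w ∈ dualLattice p B L, B x w ∈ ZLoc p := fun x hx w hw => by
    rw [hB.eq]
    exact ((mem_dualLattice_iff _ _).1 hw).2 x hx
  have hdiv : ∀ y ∈ L₀, (∀ z ∈ L₀, (p : ℚ)⁻¹ * B y z ∈ ZLoc p) → (p : ℚ)⁻¹ • y ∈ L₀ := by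
    refine fun y hy h => hsat y hy ((mem_dualLattice_of_span_eq_top p B L hspan _).2 fun x hx => ?_)
    obtain ⟨l, hl, w, hw, rfl⟩ := hdec x hx
    rw [map_smul, LinearMap.smul_apply, smul_eq_mul, map_add, mul_add, map_smul, smul_eq_mul,
      inv_mul_cancel_left₀ hp0]
    exact add_mem (h l hl) (hint y (hL₀ hy) w hw)
  have hpow : ∀ (k : ℕ) (x : V), (p : ℚ) ^ k • x ∈ L₀ → (∀ z ∈ L₀, B x z ∈ ZLoc p) → x ∈ L₀ := by
    intro k
    induction k with
    | zero => intro x hx _; simpa using hx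
    | succ k ih =>
      intro x hx h
      refine ih x ?_ h
      have := hdiv _ hx fun z hz => by
        rw [map_smul, LinearMap.smul_apply, smul_eq_mul, pow_succ', mul_assoc,
          inv_mul_cancel_left₀ hp0]
        exact mul_mem (pow_mem (natCast_mem _ p) k) (h z hz)
      rwa [pow_succ', mul_smul, inv_smul_smul₀ hp0] at this
  refine le_antisymm (fun x hx => ?_) fun x hx => ?_
  · exact (mem_dualLattice_iff _ _).2 ⟨Submodule.subset_span hx, fun y hy =>
      ((mem_dualLattice_iff _ _).1 (hL (hL₀ hx))).2 y (hL₀ hy)⟩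
  · obtain ⟨hxs, hxi⟩ := (mem_dualLattice_iff _ _).1 hx
    obtain ⟨k, hk⟩ := exists_pow_smul_mem hxs
    exact hpow k x hk hxi

/-- A unimodular sublattice splits off orthogonally. -/
theorem isOrthogonalSum_orthIn [FiniteDimensional ℚ V] (hB : B.IsSymm) (hnd : B.Nondegenerate)
    {L L₀ : Submodule (ZLoc p) V} (hspan : Submodule.span ℚ (L : Set V) = ⊤)
    (hL : L ≤ dualLattice p B L) (hL₀ : L₀ ≤ L) (huni : IsUnimodular p B L₀) :
    IsOrthogonalSum p B L L₀ (orthIn p B L L₀) := by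
  have hmem : ∀ x ∈ Submodule.span ℚ (L₀ : Set V), (∀ y ∈ L₀, B x y ∈ ZLoc p) → x ∈ L₀ :=
    fun x hx h => huni.symm.le ((mem_dualLattice_iff _ _).2 ⟨hx, h⟩)
  have hzero : ∀ x ∈ Submodule.span ℚ (L₀ : Set V), (∀ y ∈ L₀, B x y = 0) → x = 0 := by
    intro x hx h
    have hB0 : B x = 0 := by
      refine LinearMap.ext_on hspan fun y hy => eq_zero_of_forall_mul_mem_ZLoc (p := p) fun q => ?_
      -- every rational multiple of `x` lies in the dual of `L₀`, hence in the integral lattice `L`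
      have hqx : q • x ∈ L₀ := hmem _ (Submodule.smul_mem _ q hx) fun z hz => by
        simp [h z hz]
      simpa using ((mem_dualLattice_iff _ _).1 (hL (hL₀ hqx))).2 y hy
    exact LinearMap.ker_eq_bot.1 hnd.ker_eq_bot (hB0.trans (map_zero B).symm)
  have hcompl : IsCompl (Submodule.span ℚ (L₀ : Set V))
      (B.orthogonal (Submodule.span ℚ (L₀ : Set V))) := by
    refine B.isCompl_orthogonal_of_restrict_nondegenerate hB.isRefl
      (B.nondegenerate_restrict_of_disjoint_orthogonal hB.isRefl (Submodule.disjoint_def.2 ?_))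
    intro x hx hxo
    refine hzero x hx fun y hy => ?_
    rw [hB.eq]
    exact LinearMap.BilinForm.mem_orthogonal_iff.1 hxo y (Submodule.subset_span hy)
  refine ⟨le_antisymm (sup_le hL₀ fun x hx => hx.1) fun x hx => ?_, ?_, fun x hx y hy => ?_⟩
  · obtain ⟨x₀, hx₀, x₁, hx₁, rfl⟩ := Submodule.mem_sup.1
      (hcompl.sup_eq_top.ge (Submodule.mem_top (x := x)))
    have hx₁' : ∀ y ∈ L₀, B x₁ y = 0 := fun y hy => by
      rw [hB.eq]
      exact LinearMap.BilinForm.mem_orthogonal_iff.1 hx₁ y (Submodule.subset_span hy)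
    have hx₀L : x₀ ∈ L₀ := hmem x₀ hx₀ fun y hy => by
      have := ((mem_dualLattice_iff _ _).1 (hL hx)).2 y (hL₀ hy)
      simpa [hx₁' y hy] using this
    exact Submodule.add_mem_sup hx₀L ⟨(add_mem_cancel_left (hL₀ hx₀L)).1 hx, hx₁'⟩
  · exact Submodule.disjoint_def.2 fun x hx hx' => hzero x (Submodule.subset_span hx) hx'.2
  · rw [hB.eq]
    exact hy.2 x hx

theorem isPModular_orthIn {L L₀ : Submodule (ZLoc p) V}
    (hspan : Submodule.span ℚ (L : Set V) = ⊤) (hL : (p : ℚ) • dualLattice p B L ≤ L)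
    (hsum : IsOrthogonalSum p B L L₀ (orthIn p B L L₀))
    (hdec : ∀ x ∈ L, ∃ l ∈ L₀, ∃ w ∈ dualLattice p B L, x = l + (p : ℚ) • w) :
    IsPModular p B (orthIn p B L L₀) := by
  have hp0 : (p : ℚ) ≠ 0 := Nat.cast_ne_zero.2 hp.out.ne_zero
  refine le_antisymm (fun z hz => ?_) fun x hx => ?_
  · obtain ⟨x, hx, rfl⟩ := (Submodule.mem_smul_pointwise_iff_exists _ _ _).1 hz
    obtain ⟨hxs, hxi⟩ := (mem_dualLattice_iff _ _).1 hx
    have hx0 : ∀ y ∈ L₀, B x y = 0 := fun y hy => by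
      clear hx hz hxi
      induction hxs using Submodule.span_induction with
      | mem x hx => exact hx.2 y hy
      | zero => simp
      | add x z _ _ hx hz => simp_all
      | smul q x _ hx => simp_all
    refine ⟨hL ((Submodule.mem_smul_pointwise_iff_exists _ _ _).2 ⟨x, ?_, rfl⟩), fun y hy => by
      simp [hx0 y hy]⟩
    refine (mem_dualLattice_of_span_eq_top p B L hspan x).2 fun y hy => ?_
    obtain ⟨y₀, hy₀, y₁, hy₁, rfl⟩ := Submodule.mem_sup.1 (hsum.1.ge hy)
    rw [map_add, hx0 y₀ hy₀, zero_add]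
    exact hxi y₁ hy₁
  · refine (Submodule.mem_smul_pointwise_iff_exists _ _ _).2
      ⟨(p : ℚ)⁻¹ • x, (mem_dualLattice_iff _ _).2 ⟨?_, fun y hy => ?_⟩, smul_inv_smul₀ hp0 x⟩
    · exact Submodule.smul_mem _ _ (Submodule.subset_span hx)
    · obtain ⟨l, hl, w, hw, rfl⟩ := hdec x hx.1
      rw [map_smul, LinearMap.smul_apply, map_add, LinearMap.add_apply, hsum.2.2 l hl y hy,
        zero_add, map_smul, LinearMap.smul_apply, smul_eq_mul, smul_eq_mul,
        inv_mul_cancel_left₀ hp0]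
      exact ((mem_dualLattice_iff _ _).1 hw).2 y hy.1

end Lattices

/-! ### Lattices with an isometry of order `p` -/

section Equivariant

variable {p : ℕ} [hp : Fact p.Prime] {V : Type*} [AddCommGroup V] [Module ℚ V]
  {B : LinearMap.BilinForm ℚ V} {σ : V ≃ₗ[ℚ] V}

theorem zpowers_apply_apply (hσB : ∀ x y, B (σ x) (σ y) = B x y) (h : Subgroup.zpowers σ)
    (x y : V) : B ((h : V ≃ₗ[ℚ] V) x) ((h : V ≃ₗ[ℚ] V) y) = B x y := by
  obtain ⟨h, hh⟩ := h
  change B (h x) (h y) = B x y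
  let O : Subgroup (V ≃ₗ[ℚ] V) :=
    { carrier := {h | ∀ x y, B (h x) (h y) = B x y}
      one_mem' := fun _ _ => rfl
      mul_mem' := fun {g k} hg hk x y => (hg (k x) (k y)).trans (hk x y)
      inv_mem' := fun {g} hg x y => by
        rw [← hg]
        exact congrArg₂ (fun u v => B u v) (g.apply_symm_apply x) (g.apply_symm_apply y) }
  exact (Subgroup.zpowers_le (H := O)).2 hσB hh x y

theorem zpowers_apply_left (hσB : ∀ x y, B (σ x) (σ y) = B x y) (h : Subgroup.zpowers σ)
    (x y : V) : B ((h : V ≃ₗ[ℚ] V) x) y = B x (((h⁻¹ : Subgroup.zpowers σ) : V ≃ₗ[ℚ] V) y) := by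
  rw [← zpowers_apply_apply hσB h x]
  exact congrArg _ ((h : V ≃ₗ[ℚ] V).apply_symm_apply y).symm

/-- The dual of a free lattice is free, because the dual of the `ℚ`-basis of all translates of `e`
consists of all translates of the vectors dual to `e`. -/
theorem exists_isGroupRingBasis_dualLattice [Finite (Subgroup.zpowers σ)] (hnd : B.Nondegenerate)
    (hσB : ∀ x y, B (σ x) (σ y) = B x y) {L : Submodule (ZLoc p) V}
    (hspan : Submodule.span ℚ (L : Set V) = ⊤) {a : ℕ} {e : Fin a → V}
    (he : IsGroupRingBasis p σ e L) :
    ∃ f : Fin a → V, IsGroupRingBasis p σ f (dualLattice p B L) := by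
  classical
  have hL : Submodule.span (ZLoc p) (Set.range (orbitFamily σ e)) = L :=
    (span_orbitFamily p e).trans he.2
  have htop : Submodule.span ℚ (Set.range (orbitFamily σ e)) = ⊤ := by
    rwa [← hL, Submodule.span_span_of_tower] at hspan
  let b := Module.Basis.mk ((linearIndependent_groupRing_iff e).1 he.1) htop.ge
  have hb : ∀ x, b x = (x.1 : V ≃ₗ[ℚ] V) (e x.2) := fun x => by
    simp only [b, Module.Basis.mk_apply]; rfl
  let f : Fin a → V := fun i => B.dualBasis hnd b (1, i)
  have hf : ⇑(B.dualBasis hnd b) = orbitFamily σ f := by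
    rw [LinearMap.BilinForm.dualBasis_eq_iff]
    rintro ⟨h, i⟩ ⟨k, j⟩
    have : ((h⁻¹ : Subgroup.zpowers σ) : V ≃ₗ[ℚ] V) (b (k, j)) = b (h⁻¹ * k, j) := by
      rw [hb, hb]; rfl
    rw [orbitFamily, zpowers_apply_left hσB, this, LinearMap.BilinForm.apply_dualBasis_left]
    simp only [Prod.mk.injEq, inv_mul_eq_one, eq_comm (a := h)]
  refine ⟨f, (linearIndependent_groupRing_iff f).2 (hf ▸ (B.dualBasis hnd b).linearIndependent), ?_⟩
  have hLb : Submodule.span (ZLoc p) (Set.range b) = L := by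
    rw [← hL, Module.Basis.coe_mk]
  rw [← span_orbitFamily, ← hf, ← LinearMap.BilinForm.dualSubmodule_span_of_basis, hLb, dualLattice,
    hspan, Submodule.restrictScalars_top, top_inf_eq]

/-- A combination of an `R`-basis killed by the norm is divisible by `σ - 1`. -/
theorem exists_augGen_smul_eq [Fintype (Subgroup.zpowers σ)] {ι : Type*} [Fintype ι] {e : ι → V}
    (he : LinearIndependent (LocGroupRing p σ) e) {z : V}
    (hz : z ∈ Submodule.span (LocGroupRing p σ) (Set.range e)) (hN : normElt p σ • z = 0) :
    ∃ u ∈ Submodule.span (LocGroupRing p σ) (Set.range e), z = augGen p σ • u := by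
  obtain ⟨r, rfl⟩ := (Submodule.mem_span_range_iff_exists_fun _).1 hz
  rw [Finset.smul_sum] at hN
  simp only [← mul_smul] at hN
  choose s hs using fun i =>
    augGen_dvd_of_normElt_mul_eq_zero (Fintype.linearIndependent_iff.1 he _ hN i)
  refine ⟨∑ i, s i • e i, Submodule.sum_mem _ fun i _ =>
    Submodule.smul_mem _ _ (Submodule.subset_span ⟨i, rfl⟩), ?_⟩
  simp only [Finset.smul_sum, ← mul_smul, ← hs]

/-- Existence of a compatible basis. Since `L` is free, an element of `L` in `(σ - 1) L^#` is killed
by the norm and so lies in `(σ - 1) L`; this is what makes the stacked generators available. -/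
theorem exists_isCompatibleBasis [FiniteDimensional ℚ V] [Finite (Subgroup.zpowers σ)]
    (hσ : orderOf σ = p) {L : Submodule (ZLoc p) V} (hspan : Submodule.span ℚ (L : Set V) = ⊤)
    (hLel : IsElementary p B L) {a : ℕ} {e f : Fin a → V} (he : IsGroupRingBasis p σ e L)
    (hf : IsGroupRingBasis p σ f (dualLattice p B L)) :
    ∃ (g : Fin a → V) (t : ℕ), t ≤ a ∧ IsCompatibleBasis p B σ L g t := by
  cases nonempty_fintype (Subgroup.zpowers σ)
  have := isMaximal_groupRingMaxIdeal hσ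
  have hspan' : Submodule.span ℚ (dualLattice p B L : Set V) = ⊤ :=
    top_le_iff.1 (hspan.ge.trans (Submodule.span_mono hLel.2))
  have hmemL : ∀ x, x ∈ Submodule.span (LocGroupRing p σ) (Set.range e) ↔ x ∈ L := fun x => by
    rw [← he.2]; rfl
  have hmemM : ∀ x, x ∈ Submodule.span (LocGroupRing p σ) (Set.range f) ↔ x ∈ dualLattice p B L :=
    fun x => by rw [← hf.2]; rfl
  have hcM : ∀ x ∈ Submodule.span (LocGroupRing p σ) (Set.range f),
      (p : LocGroupRing p σ) • x ∈ Submodule.span (LocGroupRing p σ) (Set.range e) := fun x hx => by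
    rw [groupRing_natCast_smul, hmemL]
    exact hLel.1 ((Submodule.mem_smul_pointwise_iff_exists _ _ _).2 ⟨x, (hmemM x).1 hx, rfl⟩)
  obtain ⟨g, t, hta, hg, hgL⟩ := exists_stacked_generators (groupRingMaxIdeal p σ)
    (groupRingMaxIdeal_le_jacobson hσ) (Submodule.fg_span (Set.finite_range e))
    (fun x hx => (hmemM x).2 (hLel.2 ((hmemL x).1 hx))) hcM
    (fun x hx hxm => by
      rw [groupRingMaxIdeal, Ideal.span_insert, Submodule.sup_smul,
        Submodule.ideal_span_singleton_smul, Submodule.ideal_span_singleton_smul] at hxm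
      obtain ⟨_, hy, _, hw, rfl⟩ := Submodule.mem_sup.1 hxm
      obtain ⟨y, hyM, rfl⟩ := (Submodule.mem_smul_pointwise_iff_exists _ _ _).1 hy
      obtain ⟨w, -, rfl⟩ := (Submodule.mem_smul_pointwise_iff_exists _ _ _).1 hw
      refine ⟨y, hyM, ?_⟩
      rw [add_sub_cancel_left]
      have hwL := (Submodule.add_mem_iff_right _ (hcM y hyM)).1 hx
      obtain ⟨u, hu, huw⟩ := exists_augGen_smul_eq he.1 hwL
        (by rw [← mul_smul, normElt_mul_augGen, zero_smul])
      rw [huw]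
      exact Submodule.smul_mem_smul (Ideal.subset_span (by simp)) hu)
    (Module.Basis.span hf.1)
  refine ⟨g, t, hta, isGroupRingBasis_of_groupRingSpan_eq hspan hspan' he ?_,
    isGroupRingBasis_of_groupRingSpan_eq hspan hspan he ?_⟩
  · rw [groupRingSpan, hg]
    exact hf.2
  · simp only [groupRing_natCast_smul] at hgL
    rw [groupRingSpan, hgL]
    exact he.2

theorem exists_orthIn_eq_restrictScalars (hσB : ∀ x y, B (σ x) (σ y) = B x y)
    (L' L₀' : Submodule (LocGroupRing p σ) V) :
    ∃ M : Submodule (LocGroupRing p σ) V, M.restrictScalars (ZLoc p) =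
      orthIn p B (L'.restrictScalars (ZLoc p)) (L₀'.restrictScalars (ZLoc p)) := by
  refine exists_restrictScalars_eq fun h x hx => ⟨?_, fun y hy => ?_⟩
  · rw [← of_smul (p := p)]
    exact L'.smul_mem _ hx.1
  · rw [zpowers_apply_left hσB]
    refine hx.2 _ ?_
    rw [← of_smul (p := p)]
    exact L₀'.smul_mem _ hy

section Splitting

variable {L : Submodule (ZLoc p) V} {a t : ℕ} {g : Fin a → V}

theorem IsCompatibleBasis.span_image_le (hg : IsCompatibleBasis p B σ L g t) :
    groupRingSpan p σ (g '' {i | i.val < t}) ≤ L := by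
  rw [← hg.2.2]
  refine Submodule.restrictScalars_mono _ (Submodule.span_mono ?_)
  rintro _ ⟨i, hi, rfl⟩
  exact ⟨i, if_pos hi⟩

theorem IsCompatibleBasis.exists_eq_add_smul (hg : IsCompatibleBasis p B σ L g t) {x : V}
    (hx : x ∈ L) : ∃ l ∈ groupRingSpan p σ (g '' {i | i.val < t}), ∃ w ∈ dualLattice p B L,
      x = l + (p : ℚ) • w := by
  rw [← hg.2.2] at hx
  rw [← hg.1.2]
  replace hx : x ∈ Submodule.span (LocGroupRing p σ) _ := hx
  induction hx using Submodule.span_induction with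
  | mem x hx =>
    obtain ⟨i, rfl⟩ := hx
    by_cases hi : i.val < t
    · exact ⟨g i, Submodule.subset_span ⟨i, hi, rfl⟩, 0, zero_mem _, by simp [hi]⟩
    · exact ⟨0, zero_mem _, g i, Submodule.subset_span ⟨i, rfl⟩, by simp [hi]⟩
  | zero => exact ⟨0, zero_mem _, 0, zero_mem _, by simp⟩
  | add x y _ _ hx hy =>
    obtain ⟨l, hl, w, hw, rfl⟩ := hx
    obtain ⟨l', hl', w', hw', rfl⟩ := hy
    exact ⟨l + l', add_mem hl hl', w + w', add_mem hw hw', by rw [smul_add]; abel⟩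
  | smul r x _ hx =>
    obtain ⟨l, hl, w, hw, rfl⟩ := hx
    refine ⟨r • l, Submodule.smul_mem (Submodule.span (LocGroupRing p σ) _) r hl, r • w,
      Submodule.smul_mem (Submodule.span (LocGroupRing p σ) _) r hw, ?_⟩
    rw [smul_add, groupRing_smul_map_smul]

theorem IsCompatibleBasis.inv_smul_mem (hg : IsCompatibleBasis p B σ L g t) {y : V}
    (hy : y ∈ groupRingSpan p σ (g '' {i | i.val < t}))
    (hy' : (p : ℚ)⁻¹ • y ∈ dualLattice p B L) :
    (p : ℚ)⁻¹ • y ∈ groupRingSpan p σ (g '' {i | i.val < t}) := by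
  have hp0 : (p : ℚ) ≠ 0 := Nat.cast_ne_zero.2 hp.out.ne_zero
  rw [← hg.1.2] at hy'
  replace hy' : (p : ℚ)⁻¹ • y ∈ Submodule.span (LocGroupRing p σ) (Set.range g) := hy'
  rw [← Set.image_univ, ← Set.union_compl_self {i : Fin a | i.val < t}, Set.image_union,
    Submodule.span_union] at hy'
  obtain ⟨l, hl, m, hm, hlm⟩ := Submodule.mem_sup.1 hy'
  have hpm : (p : ℚ) • m = y - (p : ℚ) • l := by
    rw [eq_sub_iff_add_eq', ← smul_add, hlm, smul_inv_smul₀ hp0]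
  have hpm0 : (p : ℚ) • m = 0 := by
    refine Submodule.disjoint_def.1
      (hg.1.1.disjoint_span_image (disjoint_compl_right (a := {i : Fin a | i.val < t}))) _ ?_ ?_
    · rw [hpm]
      exact sub_mem hy (natCast_smul_mem (N := groupRingSpan p σ _) p hl)
    · exact natCast_smul_mem (N := groupRingSpan p σ _) p hm
  rw [← hlm, (smul_eq_zero.1 hpm0).resolve_left hp0, add_zero]
  exact hl

theorem card_subtype_val_lt {a t : ℕ} (hta : t ≤ a) :
    Fintype.card {i : Fin a // i.val < t} = t := by
  rw [Fintype.card_subtype, Fin.card_filter_val_lt, min_eq_right hta]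

/-- Projecting the vectors `p g_{t+1}, …, p g_a` along `L₀` yields an `R`-basis of the orthogonal
complement of `L₀` in `L`. -/
theorem IsCompatibleBasis.isFreeOfRank_orthIn [FiniteDimensional ℚ V]
    [Finite (Subgroup.zpowers σ)] (hσB : ∀ x y, B (σ x) (σ y) = B x y)
    (hspan : Submodule.span ℚ (L : Set V) = ⊤) (hg : IsCompatibleBasis p B σ L g t) (hta : t ≤ a)
    (hsum : IsOrthogonalSum p B L (groupRingSpan p σ (g '' {i | i.val < t}))
      (orthIn p B L (groupRingSpan p σ (g '' {i | i.val < t})))) :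
    IsFreeOfRank p σ (orthIn p B L (groupRingSpan p σ (g '' {i | i.val < t}))) (a - t) := by
  set L₀ := Submodule.span (LocGroupRing p σ) (g '' {i | i.val < t}) with hL₀
  set f : Fin a → V := fun i => if i.val < t then g i else (p : ℚ) • g i with hf
  set L' := Submodule.span (LocGroupRing p σ) (Set.range f) with hL'
  have hLL' : L'.restrictScalars (ZLoc p) = L := hg.2.2
  obtain ⟨M, hM⟩ := exists_orthIn_eq_restrictScalars hσB L' L₀
  rw [hLL'] at hM
  change IsFreeOfRank p σ (orthIn p B L (L₀.restrictScalars (ZLoc p))) (a - t)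
  change IsOrthogonalSum p B L (L₀.restrictScalars (ZLoc p))
    (orthIn p B L (L₀.restrictScalars (ZLoc p))) at hsum
  rw [← hM] at hsum ⊢
  have hsup : L₀ ⊔ M = L' := Submodule.restrictScalars_injective (ZLoc p) _ _ (by
    rw [hLL', ← hsum.1, Submodule.restrictScalars_sup])
  have hsplit : ∀ i, ∃ l ∈ L₀, ∃ m ∈ M, l + m = f i := fun i =>
    Submodule.mem_sup.1 (hsup.ge (Submodule.subset_span ⟨i, rfl⟩))
  choose l hl m hm hlm using hsplit
  set F : Fin a → V := fun i => if i.val < t then g i else m i with hF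
  have hF₀ : L₀ ≤ Submodule.span (LocGroupRing p σ) (Set.range F) := by
    refine Submodule.span_mono ?_
    rintro _ ⟨i, hi, rfl⟩
    exact ⟨i, if_pos hi⟩
  have hm' : Submodule.span (LocGroupRing p σ) (Set.range fun i : {i : Fin a // ¬ i.val < t} => m i)
      ≤ M := Submodule.span_le.2 (by rintro _ ⟨i, rfl⟩; exact hm i)
  have hmF : Submodule.span (LocGroupRing p σ)
      (Set.range fun i : {i : Fin a // ¬ i.val < t} => m i) ⊔ L₀ = L' := by
    refine le_antisymm (sup_le (hm'.trans (le_sup_right.trans hsup.le)) (le_sup_left.trans hsup.le))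
      (Submodule.span_le.2 ?_)
    · rintro _ ⟨i, rfl⟩
      by_cases hi : i.val < t
      · exact Submodule.mem_sup_right (Submodule.subset_span ⟨i, hi, by simp [hf, hi]⟩)
      · rw [SetLike.mem_coe, ← hlm i, add_comm]
        exact Submodule.add_mem_sup (Submodule.subset_span ⟨⟨i, hi⟩, rfl⟩) (hl i)
  have hFspan : Submodule.span (LocGroupRing p σ) (Set.range F) = L' := by
    rw [← hmF]
    refine le_antisymm (Submodule.span_le.2 ?_) (sup_le (Submodule.span_mono ?_) hF₀)
    · rintro _ ⟨i, rfl⟩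
      by_cases hi : i.val < t
      · exact Submodule.mem_sup_right (Submodule.subset_span ⟨i, hi, by simp [hF, hi]⟩)
      · exact Submodule.mem_sup_left (Submodule.subset_span ⟨⟨i, hi⟩, by simp [hF, hi]⟩)
    · rintro _ ⟨i, rfl⟩
      exact ⟨i, if_neg i.2⟩
  have hFbasis : IsGroupRingBasis p σ F L :=
    isGroupRingBasis_of_groupRingSpan_eq hspan hspan hg.2 (by rw [groupRingSpan, hFspan, hLL'])
  have hmM : Submodule.span (LocGroupRing p σ)
      (Set.range fun i : {i : Fin a // ¬ i.val < t} => m i) = M := by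
    refine eq_of_le_of_inf_le_of_sup_le hm' (z := L₀) ?_ ?_
    · intro x hx
      have hx0 : x = 0 := Submodule.disjoint_def.1 hsum.2.1 x hx.2 hx.1
      rw [hx0]
      exact zero_mem _
    · rw [hmF, sup_comm, hsup]
  have hmli : LinearIndependent (LocGroupRing p σ)
      fun i : {i : Fin a // ¬ i.val < t} => m i := by
    have := hFbasis.1.comp (fun i : {i : Fin a // ¬ i.val < t} => (i : Fin a))
      Subtype.val_injective
    have hFm : F ∘ (fun i : {i : Fin a // ¬ i.val < t} => (i : Fin a)) =
      fun i : {i : Fin a // ¬ i.val < t} => m i := funext fun i => if_neg i.2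
    rwa [hFm] at this
  rw [← hmM]
  refine isFreeOfRank_groupRingSpan ?_ hmli
  rw [Fintype.card_subtype_compl, Fintype.card_fin, card_subtype_val_lt hta]

end Splitting

end Equivariant

theorem theorem4p1 (p : ℕ) [Fact p.Prime]
    {V : Type*} [AddCommGroup V] [Module ℚ V] [FiniteDimensional ℚ V]
    (B : LinearMap.BilinForm ℚ V) (hBsymm : B.IsSymm) (hBnd : B.Nondegenerate)
    (L : Submodule (ZLoc p) V) (hLfg : L.FG) (hLspan : Submodule.span ℚ (L : Set V) = ⊤)
    (hLel : IsElementary p B L)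
    (σ : V ≃ₗ[ℚ] V) (hσB : ∀ x y, B (σ x) (σ y) = B x y)
    (hσL : σ '' (L : Set V) = L) (hσ : orderOf σ = p)
    (a : ℕ) (hfree : IsFreeOfRank p σ L a) :
    IsFreeOfRank p σ (dualLattice p B L) a ∧
    (∃ (g : Fin a → V) (t : ℕ), t ≤ a ∧ IsCompatibleBasis p B σ L g t) ∧
    (∀ (g : Fin a → V) (t : ℕ), t ≤ a → IsCompatibleBasis p B σ L g t →
      ∃ L₀ L₁ : Submodule (ZLoc p) V,
        L₀ = groupRingSpan p σ (g '' {i | i.val < t}) ∧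
        L₁ = orthIn p B L L₀ ∧
        IsOrthogonalSum p B L L₀ L₁ ∧
        IsUnimodular p B L₀ ∧ IsFreeOfRank p σ L₀ t ∧
        IsPModular p B L₁ ∧ IsFreeOfRank p σ L₁ (a - t)) := by
  have hfin : Finite (Subgroup.zpowers σ) :=
    Nat.finite_of_card_ne_zero (by rw [Nat.card_zpowers, hσ]; exact (Fact.out : p.Prime).ne_zero)
  obtain ⟨e, he⟩ := hfree.exists_isGroupRingBasis
  obtain ⟨f, hf⟩ := exists_isGroupRingBasis_dualLattice hBnd hσB hLspan he
  refine ⟨hf.isFreeOfRank, exists_isCompatibleBasis hσ hLspan hLel he hf,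
    fun g t hta hg => ⟨_, _, rfl, rfl, ?_⟩⟩
  have huni := isUnimodular_of_decomposition hBsymm hLspan hLel.2 hg.span_image_le
    (fun _ => hg.exists_eq_add_smul) fun _ => hg.inv_smul_mem
  have hsum := isOrthogonalSum_orthIn hBsymm hBnd hLspan hLel.2 hg.span_image_le huni
  refine ⟨hsum, huni, ?_, isPModular_orthIn hLspan hLel.1 hsum fun _ => hg.exists_eq_add_smul,
    hg.isFreeOfRank_orthIn hσB hLspan hta hsum⟩
  rw [Set.image_eq_range]
  exact isFreeOfRank_groupRingSpan (card_subtype_val_lt hta)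
    (hg.1.1.comp (fun i : {i : Fin a // i.val < t} => (i : Fin a)) Subtype.val_injective)
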